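/- Let $\Gamma=(V,E)$ be a simple graph, with $V$ of arbitrary (possibly infinite) cardinality, and let $\{M_\alpha:\alpha\in V\}$ be a family of mutually disjoint monoids with identities $1_\alpha$. The graph product $\mathscr{GP}(\Gamma,\mathcal M)$ is the monoid given by the presentation with generating set $\bigcup_{\alpha\in V}M_\alpha$ and relations (i) $1_\alpha=\epsilon$ (the empty word) for $\alpha\in V$; (ii) $x\circ y=xy$ for $\alpha\in V$ and $x,y\in M_\alpha$; (iii) $x\circ y=y\circ x$ for $x\in M_\alpha$, $y\in M_\beta$ with $(\alpha,\beta)\in E$. For a monoid $S$, a left $S$-act is finitely presented if it is isomorphic to $F/\rho$ for some finitely generated free left $S$-act $F$ and some finitely generated $S$-act congruence $\rho$ on $F$. The monoid $S$ is weakly left coherent if every finitely generated left ideal of $S$ is finitely presented as a left $S$-act. Theorem. The graph product $\mathscr{GP}(\Gamma,\mathcal M)$ is weakly left coherent if and only if $M_\alpha$ is weakly left coherent for every $\alpha\in V$. -/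

import Mathlib

/-- The defining relations of the graph product of the monoids `M α` (`α : V`) over the simple
graph `Γ`. The alphabet is the disjoint union `Σ α, M α` of the vertex monoids. -/
inductive GraphProduct.Rel {V : Type*} (Γ : SimpleGraph V) (M : V → Type*) [∀ α, Monoid (M α)] :
    FreeMonoid (Σ α, M α) → FreeMonoid (Σ α, M α) → Prop
  /-- `1_α = ε` -/
  | one (α : V) : GraphProduct.Rel Γ M (FreeMonoid.of ⟨α, 1⟩) 1
  /-- `x ∘ y = xy` for `x, y` in the same vertex monoid -/
  | mul {α : V} (x y : M α) : GraphProduct.Rel Γ M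
      (FreeMonoid.of ⟨α, x⟩ * FreeMonoid.of ⟨α, y⟩) (FreeMonoid.of ⟨α, x * y⟩)
  /-- `x ∘ y = y ∘ x` for `x, y` in vertex monoids at adjacent vertices -/
  | comm {α β : V} (h : Γ.Adj α β) (x : M α) (y : M β) : GraphProduct.Rel Γ M
      (FreeMonoid.of ⟨α, x⟩ * FreeMonoid.of ⟨β, y⟩) (FreeMonoid.of ⟨β, y⟩ * FreeMonoid.of ⟨α, x⟩)

/-- The graph product of the monoids `M α` (`α : V`) with respect to the simple graph `Γ`: the free
monoid on the disjoint union of the `M α`, modulo the congruence generated by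
`GraphProduct.Rel Γ M`. -/
def GraphProduct {V : Type*} (Γ : SimpleGraph V) (M : V → Type*) [∀ α, Monoid (M α)] : Type _ :=
  PresentedMonoid (GraphProduct.Rel Γ M)

instance GraphProduct.instMonoid {V : Type*} (Γ : SimpleGraph V) (M : V → Type*)
    [∀ α, Monoid (M α)] : Monoid (GraphProduct Γ M) :=
  inferInstanceAs (Monoid (PresentedMonoid (GraphProduct.Rel Γ M)))

/-- The `S`-act congruence on the left `S`-act `A` generated by the relation `r`: the smallest
equivalence relation containing `r` and closed under the action of `S`. -/
inductive ActCongGen (S : Type*) {A : Type*} [SMul S A] (r : A → A → Prop) : A → A → Prop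
  | of {x y : A} (h : r x y) : ActCongGen S r x y
  | refl (x : A) : ActCongGen S r x x
  | symm {x y : A} (h : ActCongGen S r x y) : ActCongGen S r y x
  | trans {x y z : A} (h₁ : ActCongGen S r x y) (h₂ : ActCongGen S r y z) : ActCongGen S r x z
  | smul (s : S) {x y : A} (h : ActCongGen S r x y) : ActCongGen S r (s • x) (s • y)

/-- The free left `S`-act on `n` generators: the disjoint union of `n` copies of `S`, on which `S`
acts by left multiplication, `s • ⟨i, t⟩ = ⟨i, s * t⟩`. -/
abbrev FreeAct (S : Type*) (n : ℕ) : Type _ := Σ _ : Fin n, S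

/-- A left `S`-act `A` is finitely presented if it is isomorphic to `F / ρ` for some finitely
generated free left `S`-act `F` and some finitely generated `S`-act congruence `ρ` on `F`, that is,
if there is a surjective morphism `F → A` of `S`-acts whose kernel is the congruence generated by a
finite set `R` of pairs. -/
def IsFinitelyPresentedAct (S A : Type*) [Monoid S] [MulAction S A] : Prop :=
  ∃ (n : ℕ) (φ : FreeAct S n →[S] A) (R : Set (FreeAct S n × FreeAct S n)),
    Function.Surjective φ ∧ R.Finite ∧
      ∀ x y, φ x = φ y ↔ ActCongGen S (fun a b => (a, b) ∈ R) x y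

/-- A monoid `S` is weakly left coherent if every finitely generated left ideal of `S` is finitely
presented as a left `S`-act. Left ideals (Mathlib's `SemigroupIdeal`) are the subacts of `S` acting
on itself by left multiplication. -/
def WeaklyLeftCoherent (S : Type*) [Monoid S] : Prop :=
  ∀ I : SemigroupIdeal S, I.FG → IsFinitelyPresentedAct S I

/-!
A monoid `S` is weakly left coherent exactly when, for all `a b : S`, the annihilator congruence
`{(u, v) | u * a = v * a}` and the left ideal `S * a ∩ S * b` are finitely generated
(`weaklyLeftCoherent_iff`). Both conditions pass to retracts, and each vertex monoid `M α` is a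
retract of the graph product `G`, which gives one direction.

For the converse, `G` is a free right `M α`-act: each `g` is uniquely `n * s` with `s ∈ M α` and `n`
having no right factor in `M α` (`RightFree α n`). This is read off from a faithful right action of
`G` on the piles of reduced words, which are canonical forms invariant under shuffling commuting
letters. The point is how this decomposition interacts with left multiplication. If `n` is right
free for `α`, then either all left multiples `u * n` are right free for `α`, or `n` may be replaced,
without changing the left ideal `G * n` and without increasing the length, by a product of letters
at neighbours of `α` (`GraphProduct.LengthLE.stablyRightFree_or`).

So peel the last letter off `a`, say `a = n * r` with `r ∈ M α` and `n` shorter than `a`. In the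
first case, `u * n * r = v * n * r` holds only if `u * n = v * n`. In the second case `n` commutes
with `M α`, and the condition splits into one about `n` in `G` and one about `r` in `M α`.
Intersections `G * a ∩ G * b` are treated in the same way, decomposing `b` at the same vertex, and
both finiteness conditions follow by induction on the length of `a`.
-/

/-! ### Weak left coherence in terms of annihilators and intersections -/

/-- An equivariant map, along a map `σ` of the acting monoids, that carries the generating pairs of
one act congruence into another act congruence carries the whole congruence into it. -/
theorem ActCongGen.map {S T A B : Type*} [SMul S A] [SMul T B] (σ : S → T) {r : A → A → Prop}
    {q : B → B → Prop} (f : A → B) (hf : ∀ s x, f (s • x) = σ s • f x)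
    (h : ∀ x y, r x y → ActCongGen T q (f x) (f y)) {x y : A} (hxy : ActCongGen S r x y) :
    ActCongGen T q (f x) (f y) := by
  induction hxy with
  | of h' => exact h _ _ h'
  | refl x => exact .refl _
  | symm _ ih => exact ih.symm
  | trans _ _ ih₁ ih₂ => exact ih₁.trans ih₂
  | smul s _ ih => rw [hf, hf]; exact ih.smul _

theorem ActCongGen.mono {S A : Type*} [SMul S A] {r q : A → A → Prop}
    (h : ∀ x y, r x y → q x y) {x y : A} (hxy : ActCongGen S r x y) : ActCongGen S q x y :=
  hxy.map id id (fun _ _ => rfl) fun _ _ h' => .of (h _ _ h')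

/-- The kernel of `f : A → B` is contained in the `S`-act congruence on `A` generated by some finite
set of pairs from that kernel. When `f` is a morphism of `S`-acts, this says that its kernel is a
finitely generated act congruence. -/
def KerFG (S : Type*) {A B : Type*} [SMul S A] (f : A → B) : Prop :=
  ∃ R : Set (A × A), R.Finite ∧ (∀ p ∈ R, f p.1 = f p.2) ∧
    ∀ x y, f x = f y → ActCongGen S (fun a b => (a, b) ∈ R) x y

/-- Finite generation of the kernel does not depend on the generators chosen for the image: it passes
from `g : B → C` to `f : A → C` as soon as each of `f`, `g` factors equivariantly through the other
and `A` is a finitely generated act. -/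
theorem KerFG.transfer {S A B C : Type*} [Monoid S] [MulAction S A] [MulAction S B]
    {f : A → C} {g : B → C} (hg : KerFG S g) (i : A → B) (j : B → A)
    (hi : ∀ (s : S) x, i (s • x) = s • i x) (hj : ∀ (s : S) x, j (s • x) = s • j x)
    (hgi : ∀ x, g (i x) = f x) (hfj : ∀ x, f (j x) = g x)
    (E : Set A) (hE : E.Finite) (hgen : ∀ x, ∃ s : S, ∃ e ∈ E, x = s • e) : KerFG S f := by
  obtain ⟨R, hR, hR₁, hR₂⟩ := hg
  refine ⟨Prod.map j j '' R ∪ (fun e => (e, j (i e))) '' E, (hR.image _).union (hE.image _), ?_, ?_⟩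
  · rintro _ (⟨p, hp, rfl⟩ | ⟨e, -, rfl⟩)
    · simp [hfj, hR₁ p hp]
    · simp [hfj, hgi]
  · intro x y hxy
    have key : ∀ x, ActCongGen S
        (fun a b => (a, b) ∈ Prod.map j j '' R ∪ (fun e => (e, j (i e))) '' E) x (j (i x)) := by
      intro x
      obtain ⟨s, e, he, rfl⟩ := hgen x
      rw [hi, hj]
      exact .smul s (.of (Or.inr ⟨e, he, rfl⟩))
    refine (key x).trans (.trans ?_ (key y).symm)
    exact (hR₂ (i x) (i y) (by rw [hgi, hgi, hxy])).map id j hj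
      fun a b hab => .of (Or.inl ⟨(a, b), hab, rfl⟩)

/-- The left annihilator congruence `{(u, v) | u * a = v * a}` of `a` is finitely generated. -/
def AnnFG {S : Type*} [Monoid S] (a : S) : Prop :=
  KerFG S (fun u : S => u * a)

/-- The intersection of the principal left ideals of `a` and `b` is finitely generated. -/
def InterFG {S : Type*} [Monoid S] (a b : S) : Prop :=
  ∃ F : Set S, F.Finite ∧ ∀ w, ((∃ u, w = u * a) ∧ ∃ v, w = v * b) ↔ ∃ f ∈ F, ∃ u, w = u * f

section

variable {S : Type*} [Monoid S]

/-- In a weakly left coherent monoid the presentation of a finitely generated left ideal on any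
finite generating family `y` is finite. -/
theorem WeaklyLeftCoherent.kerFG (h : WeaklyLeftCoherent S) {n : ℕ} (y : Fin n → S) :
    KerFG S (fun x : FreeAct S n => x.2 * y x.1) := by
  let I : SemigroupIdeal S := SemigroupIdeal.closure (Set.range y)
  obtain ⟨m, φ, R, hφ, hR, hR₂⟩ := h I ⟨_, Set.finite_range y, rfl⟩
  have hker : KerFG S (fun x : FreeAct S m => ((φ x : I) : S)) :=
    ⟨R, hR, fun p hp => congrArg _ ((hR₂ p.1 p.2).2 (.of hp)),
      fun x y hxy => (hR₂ x y).1 (Subtype.ext hxy)⟩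
  have hy : ∀ i, ∃ x, ((φ x : I) : S) = y i := fun i => by
    obtain ⟨x, hx⟩ := hφ ⟨y i, SemigroupIdeal.subset_closure ⟨i, rfl⟩⟩
    exact ⟨x, by rw [hx]⟩
  choose x hx using hy
  have hp : ∀ k, ∃ p : FreeAct S n, p.2 * y p.1 = ((φ ⟨k, 1⟩ : I) : S) := fun k => by
    obtain ⟨p, _, ⟨i, rfl⟩, hp⟩ := SemigroupIdeal.mem_closure''.1 (φ ⟨k, 1⟩ : I).2
    exact ⟨⟨i, p⟩, hp⟩
  choose p hp using hp
  have hφs : ∀ (s : S) z, ((φ (s • z) : I) : S) = s * ((φ z : I) : S) := fun s z => by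
    rw [map_smul]; rfl
  refine hker.transfer (fun z => z.2 • x z.1) (fun z => z.2 • p z.1)
    (fun s z => mul_smul _ _ _) (fun s z => mul_smul _ _ _) ?_ ?_
    (Set.range fun i => ⟨i, 1⟩) (Set.finite_range _) ?_
  · rintro ⟨i, s⟩
    simp only [hφs, hx]
  · rintro ⟨k, s⟩
    have : (⟨k, s⟩ : FreeAct S m) = s • ⟨k, 1⟩ := Sigma.ext rfl (heq_of_eq (mul_one s).symm)
    rw [this, hφs, ← hp]
    change (s * 1) * (p k).2 * y (p k).1 = s * ((p k).2 * y (p k).1)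
    rw [mul_one, mul_assoc]
  · rintro ⟨i, s⟩
    exact ⟨s, _, ⟨i, rfl⟩, Sigma.ext rfl (heq_of_eq (mul_one s).symm)⟩

theorem WeaklyLeftCoherent.annFG (h : WeaklyLeftCoherent S) (a : S) : AnnFG a := by
  refine (h.kerFG ![a]).transfer (fun u => ⟨0, u⟩) (fun z => z.2) (fun _ _ => rfl)
    (fun _ _ => rfl) (fun _ => rfl) ?_ {1} (Set.finite_singleton 1)
    fun u => ⟨u, 1, rfl, (mul_one u).symm⟩
  rintro ⟨i, u⟩
  fin_cases i; rfl

theorem WeaklyLeftCoherent.interFG (h : WeaklyLeftCoherent S) (a b : S) : InterFG a b := by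
  obtain ⟨R, hR, hR₁, hR₂⟩ := h.kerFG ![a, b]
  -- An element `u * a = v * b` links the two free generators, so some step of the derivation uses
  -- a generating pair with one entry over each generator.
  refine ⟨(fun p => p.1.2 * ![a, b] p.1.1) '' {p ∈ R | p.1.1 ≠ p.2.1}, (hR.subset
    (Set.sep_subset _ _)).image _, fun w => ⟨?_, ?_⟩⟩
  · rintro ⟨⟨u, rfl⟩, v, hv⟩
    have key : ∀ x y : FreeAct S 2, ActCongGen S (fun a b => (a, b) ∈ R) x y →
        x.2 * ![a, b] x.1 = y.2 * ![a, b] y.1 ∧ (x.1 ≠ y.1 →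
        ∃ f ∈ (fun p : FreeAct S 2 × FreeAct S 2 => p.1.2 * ![a, b] p.1.1) ''
          {p ∈ R | p.1.1 ≠ p.2.1}, ∃ u, x.2 * ![a, b] x.1 = u * f) := by
      intro x y hxy
      induction hxy with
      | @of x y h => exact ⟨hR₁ _ h, fun hne => ⟨_, ⟨(x, y), ⟨h, hne⟩, rfl⟩, 1, (one_mul _).symm⟩⟩
      | refl x => exact ⟨rfl, fun h => absurd rfl h⟩
      | symm _ ih => exact ⟨ih.1.symm, fun h => by rw [← ih.1]; exact ih.2 h.symm⟩
      | @trans x y z _ _ ih₁ ih₂ =>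
        refine ⟨ih₁.1.trans ih₂.1, fun h => ?_⟩
        by_cases hxy : x.1 = y.1
        · rw [ih₁.1]; exact ih₂.2 (hxy ▸ h)
        · exact ih₁.2 hxy
      | @smul s x y _ ih =>
        refine ⟨?_, fun h => ?_⟩
        · change s * x.2 * ![a, b] x.1 = s * y.2 * ![a, b] y.1
          rw [mul_assoc, mul_assoc, ih.1]
        · obtain ⟨f, hf, u, hu⟩ := ih.2 h
          refine ⟨f, hf, s * u, ?_⟩
          change s * x.2 * ![a, b] x.1 = s * u * f
          rw [mul_assoc, mul_assoc, hu]
    exact (key ⟨0, u⟩ ⟨1, v⟩ (hR₂ _ _ hv)).2 (by simp)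
  · rintro ⟨_, ⟨⟨⟨i, p⟩, ⟨j, q⟩⟩, ⟨hp, hij⟩, rfl⟩, u, rfl⟩
    have e := hR₁ _ hp
    fin_cases i <;> fin_cases j
    · exact absurd rfl hij
    · exact ⟨⟨u * p, by simp [mul_assoc]⟩, u * q, by simp at e; simp [mul_assoc, e]⟩
    · exact ⟨⟨u * q, by simp at e; simp [mul_assoc, e]⟩, u * p, by simp [mul_assoc]⟩
    · exact absurd rfl hij

/-- If annihilators and pairwise intersections of principal left ideals are finitely generated, the
presentation of a finitely generated left ideal needs the annihilator relations of each generator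
and, for each pair of generators, one relation per generator of the intersection. -/
theorem kerFG_of_annFG_of_interFG (h₁ : ∀ a : S, AnnFG a) (h₂ : ∀ a b : S, InterFG a b) {n : ℕ}
    (y : Fin n → S) : KerFG S (fun x : FreeAct S n => x.2 * y x.1) := by
  choose H hH hH₁ hH₂ using fun i => h₁ (y i)
  choose F hF hF₁ using fun i j => h₂ (y i) (y j)
  have hc : ∀ i j (c : F i j), ∃ p : S × S, (c : S) = p.1 * y i ∧ (c : S) = p.2 * y j :=
    fun i j c => by
      obtain ⟨⟨u, hu⟩, v, hv⟩ := (hF₁ i j c).2 ⟨c, c.2, 1, (one_mul _).symm⟩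
      exact ⟨(u, v), hu, hv⟩
  choose p hp₁ hp₂ using hc
  have _ : ∀ i j, Finite (F i j) := hF
  let R : Set (FreeAct S n × FreeAct S n) :=
    (⋃ i, (fun q : S × S => (⟨i, q.1⟩, ⟨i, q.2⟩)) '' H i) ∪
    Set.range fun z : Σ i : Fin n, Σ j : Fin n, F i j =>
      (⟨z.1, (p _ _ z.2.2).1⟩, ⟨z.2.1, (p _ _ z.2.2).2⟩)
  refine ⟨R, (Set.finite_iUnion fun i => (hH i).image _).union (Set.finite_range _), ?_, ?_⟩
  · rintro _ (h | ⟨⟨i, j, c⟩, rfl⟩)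
    · obtain ⟨i, q, hq, rfl⟩ := Set.mem_iUnion.1 h
      exact hH₁ i q hq
    · exact (hp₁ i j c).symm.trans (hp₂ i j c)
  · rintro ⟨i, u⟩ ⟨j, v⟩ huv
    obtain ⟨c, hc, s, hs⟩ := (hF₁ i j (u * y i)).1 ⟨⟨u, rfl⟩, v, huv⟩
    have lift : ∀ i u v, u * y i = v * y i →
        ActCongGen S (fun a b => (a, b) ∈ R) (⟨i, u⟩ : FreeAct S n) ⟨i, v⟩ := by
      intro i u v h
      refine (hH₂ i u v h).map id (fun u => (⟨i, u⟩ : FreeAct S n)) (fun _ _ => rfl) ?_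
      exact fun a b hab => .of (Or.inl (Set.mem_iUnion.2 ⟨i, (a, b), hab, rfl⟩))
    refine (lift i u (s * (p i j ⟨c, hc⟩).1) ?_).trans (.trans ?_
      (lift j (s * (p i j ⟨c, hc⟩).2) v ?_))
    · rw [hs, mul_assoc, ← hp₁]
    · exact .smul s (x := (⟨i, (p i j ⟨c, hc⟩).1⟩ : FreeAct S n)) (y := ⟨j, (p i j ⟨c, hc⟩).2⟩)
        (.of (Or.inr ⟨⟨i, j, ⟨c, hc⟩⟩, rfl⟩))
    · rw [mul_assoc, ← hp₂, ← hs]; exact huv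

theorem WeaklyLeftCoherent.of_kerFG
    (h : ∀ (n : ℕ) (y : Fin n → S), KerFG S (fun x : FreeAct S n => x.2 * y x.1)) :
    WeaklyLeftCoherent S := by
  rintro I ⟨s, hs, rfl⟩
  obtain ⟨n, y, -, rfl⟩ := hs.fin_param
  obtain ⟨R, hR, hR₁, hR₂⟩ := h n y
  have hmem : ∀ x : FreeAct S n, x.2 * y x.1 ∈ SemigroupIdeal.closure (Set.range y) := fun x =>
    SemigroupIdeal.mem_closure''.2 ⟨x.2, _, ⟨x.1, rfl⟩, rfl⟩
  refine ⟨n, ⟨fun x => ⟨x.2 * y x.1, hmem x⟩, fun s x => Subtype.ext (mul_assoc _ _ _)⟩, R, ?_, hR,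
    fun a b => ⟨fun hab => hR₂ a b (congrArg Subtype.val hab), fun hab => ?_⟩⟩
  · rintro ⟨w, hw⟩
    obtain ⟨u, _, ⟨i, rfl⟩, rfl⟩ := SemigroupIdeal.mem_closure''.1 hw
    exact ⟨⟨i, u⟩, rfl⟩
  · refine Subtype.ext ?_
    change a.2 * y a.1 = b.2 * y b.1
    induction hab with
    | of h' => exact hR₁ _ h'
    | refl x => rfl
    | symm _ ih => exact ih.symm
    | trans _ _ ih₁ ih₂ => exact ih₁.trans ih₂
    | @smul s x z _ ih =>
      change s * x.2 * y x.1 = s * z.2 * y z.1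
      rw [mul_assoc, mul_assoc, ih]

/-- A monoid is weakly left coherent exactly when its left annihilator congruences and the
intersections of its principal left ideals are finitely generated. -/
theorem weaklyLeftCoherent_iff :
    WeaklyLeftCoherent S ↔ (∀ a : S, AnnFG a) ∧ ∀ a b : S, InterFG a b :=
  ⟨fun h => ⟨h.annFG, h.interFG⟩,
    fun h => .of_kerFG fun _ => kerFG_of_annFG_of_interFG h.1 h.2⟩

/-- Weak left coherence passes to retracts: apply the retraction to the finite generating sets. -/
theorem WeaklyLeftCoherent.of_retract {T : Type*} [Monoid T] (h : WeaklyLeftCoherent S)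
    (ι : T →* S) (π : S →* T) (hπ : ∀ t, π (ι t) = t) : WeaklyLeftCoherent T := by
  refine weaklyLeftCoherent_iff.2 ⟨fun a => ?_, fun a b => ?_⟩
  · obtain ⟨R, hR, hR₁, hR₂⟩ := h.annFG (ι a)
    refine ⟨Prod.map π π '' R, hR.image _, ?_, fun u v huv => ?_⟩
    · rintro _ ⟨p, hp, rfl⟩
      simpa [hπ] using congrArg π (hR₁ p hp)
    · have := (hR₂ (ι u) (ι v) (by simpa using congrArg ι huv)).map (T := T) π π
        (fun s x => map_mul π s x) (q := fun a b => (a, b) ∈ Prod.map π π '' R)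
        fun x y hxy => .of ⟨(x, y), hxy, rfl⟩
      rwa [hπ, hπ] at this
  · obtain ⟨F, hF, hF₁⟩ := h.interFG (ι a) (ι b)
    refine ⟨π '' F, hF.image _, fun w => ⟨?_, ?_⟩⟩
    · rintro ⟨⟨u, hu⟩, v, hv⟩
      obtain ⟨f, hf, s, hs⟩ := (hF₁ (ι w)).1 ⟨⟨ι u, by rw [hu, map_mul]⟩, ι v, by rw [hv, map_mul]⟩
      exact ⟨_, ⟨f, hf, rfl⟩, π s, by rw [← hπ w, hs, map_mul]⟩
    · rintro ⟨_, ⟨f, hf, rfl⟩, s, rfl⟩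
      obtain ⟨⟨u, hu⟩, v, hv⟩ := (hF₁ f).2 ⟨f, hf, 1, (one_mul _).symm⟩
      exact ⟨⟨s * π u, by rw [hu, map_mul, hπ, mul_assoc]⟩, s * π v,
        by rw [hv, map_mul, hπ, mul_assoc]⟩

/-! ### Change of generator of a principal left ideal -/

/-- `a` and `b` generate the same principal left ideal. -/
def LeftAssoc (a b : S) : Prop :=
  (∃ p, a = p * b) ∧ ∃ q, b = q * a

theorem LeftAssoc.refl (a : S) : LeftAssoc a a :=
  ⟨⟨1, (one_mul a).symm⟩, 1, (one_mul a).symm⟩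

theorem LeftAssoc.trans {a b c : S} (h : LeftAssoc a b)
    (h' : LeftAssoc b c) : LeftAssoc a c := by
  obtain ⟨⟨p, rfl⟩, q, hq⟩ := h
  obtain ⟨⟨p', rfl⟩, q', hq'⟩ := h'
  exact ⟨⟨p * p', (mul_assoc _ _ _).symm⟩, q' * q, by rw [mul_assoc, ← hq, ← hq']⟩

theorem LeftAssoc.mul_right {a b : S} (h : LeftAssoc a b) (x : S) :
    LeftAssoc (a * x) (b * x) := by
  obtain ⟨⟨p, hp⟩, q, hq⟩ := h
  exact ⟨⟨p, by rw [← mul_assoc, ← hp]⟩, q, by rw [← mul_assoc, ← hq]⟩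

theorem AnnFG.of_leftAssoc {a b : S} (h : AnnFG a) (hab : LeftAssoc a b) :
    AnnFG b := by
  obtain ⟨⟨p, hp⟩, q, hq⟩ := hab
  exact h.transfer (· * q) (· * p) (fun s x => mul_assoc _ _ _) (fun s x => mul_assoc _ _ _)
    (fun x => by simp only [mul_assoc, ← hq]) (fun x => by simp only [mul_assoc, ← hp])
    {1} (Set.finite_singleton 1) fun u => ⟨u, 1, rfl, (mul_one u).symm⟩

theorem InterFG.symm {a b : S} (h : InterFG a b) : InterFG b a :=
  h.imp fun _ hF => ⟨hF.1, fun _ => and_comm.trans (hF.2 _)⟩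

theorem InterFG.of_leftAssoc {a b a' : S} (h : InterFG a b)
    (ha : LeftAssoc a a') : InterFG a' b := by
  obtain ⟨⟨p, hp⟩, q, hq⟩ := ha
  refine h.imp fun F hF => ⟨hF.1, fun w => (and_congr_left' ⟨?_, ?_⟩).trans (hF.2 w)⟩
  · rintro ⟨u, rfl⟩
    exact ⟨u * q, by rw [mul_assoc, ← hq]⟩
  · rintro ⟨u, rfl⟩
    exact ⟨u * p, by rw [mul_assoc, ← hp]⟩

theorem InterFG.of_forall_not {a b : S} (h : ∀ u v, u * a ≠ v * b) :
    InterFG a b :=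
  ⟨∅, Set.finite_empty, fun _ => ⟨fun ⟨⟨u, hu⟩, v, hv⟩ => absurd (hu.symm.trans hv) (h u v),
    fun ⟨_, hf, _⟩ => hf.elim⟩⟩

end


/-! ### Reduced piles: a faithful model of the graph product -/

/-- A pile assigns to each set `D` of pairwise non-adjacent vertices a list of letters. The pile of a
reduced word records, for each `D`, the letters of the word at vertices of `D`, last letter first;
shuffling commuting letters of the word does not change it. -/
abbrev Pile {V : Type*} (Γ : SimpleGraph V) (M : V → Type*) : Type _ :=
  {D : Set V // Γ.IsIndepSet D} → List (Σ α, M α)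

namespace Pile

variable {V : Type*} {Γ : SimpleGraph V} {M : V → Type*}

open Classical in
/-- Append the letter `s` on the right of the word described by `π`. -/
noncomputable def push (β : V) (s : M β) (π : Pile Γ M) : Pile Γ M :=
  fun D => if β ∈ D.1 then ⟨β, s⟩ :: π D else π D

/-- The word described by `π` can be shuffled so as to end with the letter `s`. -/
def Top (β : V) (s : M β) (π : Pile Γ M) : Prop :=
  ∀ D, β ∈ D.1 → (π D).head? = some ⟨β, s⟩

/-- The word described by `π` cannot be shuffled so as to end with a letter of `M β`. -/
def NoTop (β : V) (π : Pile Γ M) : Prop :=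
  ∀ s, ¬ Top β s π

theorem push_of_mem {β : V} {s : M β} {π : Pile Γ M} {D : {D : Set V // Γ.IsIndepSet D}}
    (h : β ∈ D.1) : push β s π D = ⟨β, s⟩ :: π D :=
  if_pos h

theorem push_of_notMem {β : V} {s : M β} {π : Pile Γ M} {D : {D : Set V // Γ.IsIndepSet D}}
    (h : β ∉ D.1) : push β s π D = π D :=
  if_neg h

theorem notMem_of_adj {β γ : V} (h : Γ.Adj β γ) {D : {D : Set V // Γ.IsIndepSet D}}
    (hβ : β ∈ D.1) : γ ∉ D.1 :=
  fun hγ => D.2 hβ hγ h.ne h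

theorem top_push (β : V) (s : M β) (π : Pile Γ M) : Top β s (push β s π) := fun D h => by
  rw [push_of_mem h]; rfl

theorem Top.unique {β : V} {s t : M β} {π : Pile Γ M} (hs : Top β s π) (ht : Top β t π) :
    s = t := by
  have h := (hs ⟨{β}, Set.pairwise_singleton _ _⟩ rfl).symm.trans (ht _ rfl)
  simpa using h

theorem noTop_empty (β : V) : NoTop β (fun _ => [] : Pile Γ M) := fun s h => by
  simpa using h ⟨{β}, Set.pairwise_singleton _ _⟩ rfl

theorem top_push_of_adj {β γ : V} (h : Γ.Adj β γ) {s : M β} {t : M γ} {π : Pile Γ M} :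
    Top β s (push γ t π) ↔ Top β s π :=
  forall₂_congr fun D hβ => by rw [push_of_notMem (notMem_of_adj h hβ)]

theorem noTop_push_of_adj {β γ : V} (h : Γ.Adj β γ) {t : M γ} {π : Pile Γ M} :
    NoTop β (push γ t π) ↔ NoTop β π :=
  forall_congr' fun _ => not_congr (top_push_of_adj h)

theorem noTop_push_of_not_adj {β γ : V} (hne : β ≠ γ) (h : ¬ Γ.Adj β γ) {t : M γ} {π : Pile Γ M} :
    NoTop β (push γ t π) := fun s hs => by
  -- The letter `t` covers every letter of `M β` in the list of the independent set `{β, γ}`.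
  have hD : Γ.IsIndepSet {β, γ} :=
    Set.pairwise_pair.2 fun _ => ⟨h, fun h' => h h'.symm⟩
  have := hs ⟨{β, γ}, hD⟩ (by simp)
  rw [push_of_mem (by simp)] at this
  simp only [List.head?_cons, Option.some.injEq, Sigma.mk.injEq] at this
  exact hne this.1.symm

theorem push_injective (β : V) (s : M β) : Function.Injective (push (Γ := Γ) β s) := by
  intro π π' h
  funext D
  have hD := congrFun h D
  by_cases hβ : β ∈ D.1
  · rw [push_of_mem hβ, push_of_mem hβ] at hD
    exact (List.cons.inj hD).2
  · rwa [push_of_notMem hβ, push_of_notMem hβ] at hD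

theorem push_comm {β γ : V} (h : Γ.Adj β γ) (s : M β) (t : M γ) (π : Pile Γ M) :
    push β s (push γ t π) = push γ t (push β s π) := by
  funext D
  by_cases hβ : β ∈ D.1
  · rw [push_of_mem hβ, push_of_notMem (notMem_of_adj h hβ), push_of_notMem (notMem_of_adj h hβ),
      push_of_mem hβ]
  · rw [push_of_notMem hβ]
    by_cases hγ : γ ∈ D.1
    · rw [push_of_mem hγ, push_of_mem hγ, push_of_notMem hβ]
    · rw [push_of_notMem hγ, push_of_notMem hγ, push_of_notMem hβ]

variable [∀ α, Monoid (M α)]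

open Classical in
/-- Append the letter `s`, unless it is the identity. -/
noncomputable def ins (β : V) (s : M β) (π : Pile Γ M) : Pile Γ M :=
  if s = 1 then π else push β s π

@[simp] theorem ins_one (β : V) (π : Pile Γ M) : ins β 1 π = π :=
  if_pos rfl

theorem ins_of_ne {β : V} {s : M β} (h : s ≠ 1) (π : Pile Γ M) : ins β s π = push β s π :=
  if_neg h

theorem noTop_ins_of_adj {β γ : V} (h : Γ.Adj β γ) {t : M γ} {π : Pile Γ M} :
    NoTop β (ins γ t π) ↔ NoTop β π := by
  by_cases ht : t = 1
  · rw [ht, ins_one]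
  · rw [ins_of_ne ht, noTop_push_of_adj h]

theorem ins_comm {β γ : V} (h : Γ.Adj β γ) (s : M β) (t : M γ) (π : Pile Γ M) :
    ins β s (ins γ t π) = ins γ t (ins β s π) := by
  by_cases hs : s = 1
  · rw [hs, ins_one, ins_one]
  by_cases ht : t = 1
  · rw [ht, ins_one, ins_one]
  rw [ins_of_ne hs, ins_of_ne hs, ins_of_ne ht, ins_of_ne ht, push_comm h]

/-- The last letter in `M β` (or `1`), and the pile below it, are determined by the pile. -/
theorem ins_inj {β : V} {s t : M β} {π π' : Pile Γ M} (hπ : NoTop β π) (hπ' : NoTop β π')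
    (h : ins β s π = ins β t π') : π = π' ∧ s = t := by
  by_cases hs : s = 1 <;> by_cases ht : t = 1
  · subst hs ht
    exact ⟨by simpa using h, rfl⟩
  · rw [hs, ins_one, ins_of_ne ht] at h
    exact absurd (h ▸ top_push β t π') (hπ t)
  · rw [ht, ins_one, ins_of_ne hs] at h
    exact absurd (h ▸ top_push β s π) (hπ' s)
  · rw [ins_of_ne hs, ins_of_ne ht] at h
    obtain rfl : s = t := (top_push β s π).unique (h ▸ top_push β t π')
    exact ⟨push_injective β s h, rfl⟩

/-- The piles of reduced words: a letter is appended only if it is not the identity and cannot be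
merged with an earlier letter at the same vertex. -/
inductive Reduced : Pile Γ M → Prop
  | empty : Reduced fun _ => []
  | push {π : Pile Γ M} (β : V) (s : M β) (hπ : Reduced π) (hβ : NoTop β π) (hs : s ≠ 1) :
      Reduced (Pile.push β s π)

theorem Reduced.ins {π : Pile Γ M} (hπ : Reduced π) {β : V} (hβ : NoTop β π) (s : M β) :
    Reduced (Pile.ins β s π) := by
  by_cases hs : s = 1
  · rwa [hs, ins_one]
  · rw [ins_of_ne hs]
    exact hπ.push β s hβ hs

theorem Reduced.exists_ins {π : Pile Γ M} (hπ : Reduced π) (β : V) :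
    ∃ (π' : Pile Γ M) (s : M β), Reduced π' ∧ NoTop β π' ∧ π = Pile.ins β s π' := by
  induction hπ with
  | empty => exact ⟨_, 1, .empty, noTop_empty β, (ins_one _ _).symm⟩
  | @push π γ t hπ hγ ht ih =>
    by_cases hβγ : β = γ
    · subst hβγ
      exact ⟨π, t, hπ, hγ, (ins_of_ne ht _).symm⟩
    by_cases hadj : Γ.Adj β γ
    · obtain ⟨π', s, hπ', hβ, rfl⟩ := ih
      refine ⟨Pile.ins γ t π', s, hπ'.ins ((noTop_ins_of_adj hadj.symm).1 hγ) t,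
        (noTop_ins_of_adj hadj).2 hβ, ?_⟩
      rw [ins_comm hadj, ins_of_ne ht]
    · exact ⟨_, 1, hπ.push γ t hγ ht, noTop_push_of_not_adj hβγ hadj, (ins_one _ _).symm⟩

end Pile

/-- The reduced piles. -/
abbrev RedPile {V : Type*} (Γ : SimpleGraph V) (M : V → Type*) [∀ α, Monoid (M α)] : Type _ :=
  {π : Pile Γ M // π.Reduced}

namespace RedPile

open Pile

variable {V : Type*} {Γ : SimpleGraph V} {M : V → Type*} [∀ α, Monoid (M α)]

/-- Right multiplication by `x ∈ M β`: the last letter `s` in `M β` (or `1`) becomes `s * x`. -/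
noncomputable def act (β : V) (x : M β) (π : RedPile Γ M) : RedPile Γ M :=
  let h := (π.2.exists_ins β).choose_spec
  ⟨ins β (h.choose * x) (π.2.exists_ins β).choose, h.choose_spec.1.ins h.choose_spec.2.1 _⟩

theorem exists_eq_ins (π : RedPile Γ M) (β : V) : ∃ (π' : RedPile Γ M) (s : M β)
    (h : NoTop β π'.1), π = ⟨ins β s π'.1, π'.2.ins h s⟩ := by
  obtain ⟨π', s, hπ', hβ, h⟩ := π.2.exists_ins β
  exact ⟨⟨π', hπ'⟩, s, hβ, Subtype.ext h⟩

theorem act_ins {π : RedPile Γ M} {β : V} (hβ : NoTop β π.1) (s x : M β)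
    (h : (ins β s π.1).Reduced) : (act β x ⟨ins β s π.1, h⟩).1 = ins β (s * x) π.1 := by
  have h' := (h.exists_ins β).choose_spec.choose_spec
  obtain ⟨h₁, h₂⟩ := ins_inj hβ h'.2.1 h'.2.2
  exact (congrArg₂ (fun t π' => ins β (t * x) π') h₂ h₁).symm

theorem act_of_noTop {π : RedPile Γ M} {β : V} (hβ : NoTop β π.1) (x : M β) :
    (act β x π).1 = ins β x π.1 := by
  have := act_ins hβ 1 x (by rw [ins_one]; exact π.2)
  simpa using this

theorem act_one (β : V) (π : RedPile Γ M) : act β 1 π = π := by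
  obtain ⟨π, s, hβ, rfl⟩ := π.exists_eq_ins β
  exact Subtype.ext (by rw [act_ins hβ, mul_one])

theorem act_act (β : V) (x y : M β) (π : RedPile Γ M) : act β y (act β x π) = act β (x * y) π := by
  obtain ⟨π, s, hβ, rfl⟩ := π.exists_eq_ins β
  have h : act β x ⟨ins β s π.1, π.2.ins hβ s⟩ = ⟨ins β (s * x) π.1, π.2.ins hβ _⟩ :=
    Subtype.ext (act_ins hβ _ _ _)
  exact Subtype.ext (by rw [h, act_ins hβ, act_ins hβ, mul_assoc])

theorem act_comm {β γ : V} (h : Γ.Adj β γ) (x : M β) (y : M γ) (π : RedPile Γ M) :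
    act γ y (act β x π) = act β x (act γ y π) := by
  obtain ⟨π, s, hβ, rfl⟩ := π.exists_eq_ins β
  obtain ⟨π, t, hγ, rfl⟩ := π.exists_eq_ins γ
  have hβ' : NoTop β π.1 := (noTop_ins_of_adj h).1 hβ
  have key : ∀ s t, NoTop β (ins γ t π.1) ∧ NoTop γ (ins β s π.1) := fun s t =>
    ⟨(noTop_ins_of_adj h).2 hβ', (noTop_ins_of_adj h.symm).2 hγ⟩
  have hred : ∀ s t, (ins β s (ins γ t π.1)).Reduced := fun s t =>
    (π.2.ins hγ t).ins (key s t).1 s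
  have hβx : ∀ s t, act β x ⟨ins β s (ins γ t π.1), hred s t⟩ =
      ⟨ins β (s * x) (ins γ t π.1), hred _ _⟩ := fun s t =>
    Subtype.ext (act_ins (π := ⟨ins γ t π.1, π.2.ins hγ t⟩) (key s t).1 _ _ _)
  have hγy : ∀ s t, act γ y ⟨ins β s (ins γ t π.1), hred s t⟩ =
      ⟨ins β s (ins γ (t * y) π.1), hred _ _⟩ := fun s t => by
    refine Subtype.ext ?_
    have := act_ins (π := ⟨ins β s π.1, π.2.ins hβ' s⟩) (key s t).2 t y
      ((ins_comm h s t π.1) ▸ hred s t)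
    simp only [ins_comm h]
    exact this
  rw [hβx, hγy, hγy, hβx]

end RedPile

namespace GraphProduct

open Pile

variable {V : Type*} {Γ : SimpleGraph V} {M : V → Type*} [∀ α, Monoid (M α)]

/-- The canonical homomorphism from a vertex monoid to the graph product. -/
def of (β : V) : M β →* GraphProduct Γ M where
  toFun x := PresentedMonoid.of (Rel Γ M) ⟨β, x⟩
  map_one' := PresentedMonoid.mk_eq_mk_of_rel (.one β)
  map_mul' x y := (PresentedMonoid.mk_eq_mk_of_rel (.mul x y)).symm

theorem of_mul_of_comm {β γ : V} (h : Γ.Adj β γ) (x : M β) (y : M γ) :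
    (of β x * of γ y : GraphProduct Γ M) = of γ y * of β x :=
  PresentedMonoid.mk_eq_mk_of_rel (.comm h x y)

/-- The universal property of the graph product. -/
def lift {N : Type*} [Monoid N] (f : ∀ β, M β →* N)
    (hf : ∀ β γ, Γ.Adj β γ → ∀ x y, f β x * f γ y = f γ y * f β x) : GraphProduct Γ M →* N :=
  PresentedMonoid.lift (fun z : Σ α, M α => f z.1 z.2) (by
    intro a b h
    induction h with
    | one α => simp
    | mul x y => simp
    | comm h x y => simpa using hf _ _ h x y)

@[simp] theorem lift_of {N : Type*} [Monoid N] (f : ∀ β, M β →* N)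
    (hf : ∀ β γ, Γ.Adj β γ → ∀ x y, f β x * f γ y = f γ y * f β x) (β : V) (x : M β) :
    lift f hf (of β x : GraphProduct Γ M) = f β x :=
  PresentedMonoid.lift_of _ _

/-- Every vertex monoid is a retract: kill all the other vertices. -/
theorem exists_retraction (Γ : SimpleGraph V) (M : V → Type*) [∀ α, Monoid (M α)] (α : V) :
    ∃ π : GraphProduct Γ M →* M α, ∀ x, π (of α x) = x := by
  classical
  let f : ∀ β, M β →* M α := fun β =>
    if h : β = α then h ▸ MonoidHom.id (M β) else 1
  have hf : ∀ β, β ≠ α → ∀ x, f β x = 1 := fun β h x => by simp [f, h]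
  refine ⟨lift f fun β γ h x y => ?_, fun x => by simp [f]⟩
  by_cases hβ : β = α
  · rw [hf γ (fun hγ => h.ne (hβ.trans hγ.symm)), mul_one, one_mul]
  · rw [hf β hβ, mul_one, one_mul]

@[elab_as_elim]
theorem induction_right {P : GraphProduct Γ M → Prop} (one : P 1)
    (mul : ∀ g β (x : M β), P g → P (g * of β x)) (g : GraphProduct Γ M) : P g := by
  have hg : (g : PresentedMonoid (Rel Γ M)) ∈ Submonoid.closure (Set.range
      (PresentedMonoid.of (Rel Γ M))) := by
    rw [PresentedMonoid.closure_range_of]; trivial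
  induction hg using Submonoid.closure_induction_right with
  | one => exact one
  | mul_right g _ y hy ih =>
    obtain ⟨⟨β, x⟩, rfl⟩ := hy
    exact mul g β x ih

@[elab_as_elim]
theorem induction_left {P : GraphProduct Γ M → Prop} (one : P 1)
    (mul : ∀ g β (x : M β), P g → P (of β x * g)) (g : GraphProduct Γ M) : P g := by
  have hg : (g : PresentedMonoid (Rel Γ M)) ∈ Submonoid.closure (Set.range
      (PresentedMonoid.of (Rel Γ M))) := by
    rw [PresentedMonoid.closure_range_of]; trivial
  induction hg using Submonoid.closure_induction_left with
  | one => exact one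
  | mul_left y hy g _ ih =>
    obtain ⟨⟨β, x⟩, rfl⟩ := hy
    exact mul g β x ih

/-- The right action of the graph product on reduced piles. -/
noncomputable def actHom (Γ : SimpleGraph V) (M : V → Type*) [∀ α, Monoid (M α)] :
    GraphProduct Γ M →* (Function.End (RedPile Γ M))ᵐᵒᵖ :=
  lift (fun β =>
    { toFun := fun x => .op (RedPile.act β x)
      map_one' := congrArg MulOpposite.op (funext fun π => RedPile.act_one β π)
      map_mul' := fun x y => congrArg MulOpposite.op
        (funext fun π => (RedPile.act_act β x y π).symm) })
    fun _ _ h x y => congrArg MulOpposite.op (funext fun π => RedPile.act_comm h x y π)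

/-- The reduced pile of an element of the graph product. -/
noncomputable def pile (g : GraphProduct Γ M) : RedPile Γ M :=
  (actHom Γ M g).unop ⟨_, .empty⟩

theorem pile_one : (pile (1 : GraphProduct Γ M)).1 = fun _ => [] := by
  rw [pile, map_one]; rfl

theorem pile_mul_of (g : GraphProduct Γ M) (β : V) (x : M β) :
    pile (g * of β x) = RedPile.act β x (pile g) := by
  rw [pile, map_mul, actHom, lift_of]; rfl

/-- `g` has no nontrivial right factor in `M α` that a reduced expression of `g` exhibits. These
elements form the basis of the graph product as a free right `M α`-act. -/
def RightFree (α : V) (g : GraphProduct Γ M) : Prop :=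
  NoTop α (pile g).1

theorem RightFree.one (α : V) : RightFree α (1 : GraphProduct Γ M) := by
  rw [RightFree, pile_one]; exact noTop_empty α

theorem RightFree.pile_mul_of {α : V} {g : GraphProduct Γ M} (hg : RightFree α g) (x : M α) :
    (pile (g * of α x)).1 = ins α x (pile g).1 := by
  rw [GraphProduct.pile_mul_of, RedPile.act_of_noTop hg]

/-! ### Right decompositions -/

/-- `g` is a product of at most `k` letters. -/
inductive LengthLE : ℕ → GraphProduct Γ M → Prop
  | one (k : ℕ) : LengthLE k 1
  | mul {k : ℕ} {g : GraphProduct Γ M} (hg : LengthLE k g) (β : V) (x : M β) :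
      LengthLE (k + 1) (g * of β x)

theorem LengthLE.mono {k l : ℕ} {g : GraphProduct Γ M} (hg : LengthLE k g) (h : k ≤ l) :
    LengthLE l g := by
  induction hg generalizing l with
  | one k => exact .one l
  | mul _ β x ih =>
    obtain ⟨l, rfl⟩ := Nat.exists_eq_succ_of_ne_zero (Nat.ne_zero_of_lt h)
    exact .mul (ih (Nat.le_of_succ_le_succ h)) β x

theorem exists_lengthLE (g : GraphProduct Γ M) : ∃ k, LengthLE k g := by
  induction g using induction_right with
  | one => exact ⟨0, .one 0⟩
  | mul g β x ih => exact ih.imp' (· + 1) fun _ h => h.mul β x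

theorem RightFree.mul_of_adj {α β : V} {g : GraphProduct Γ M} (hg : RightFree α g)
    (h : Γ.Adj α β) (x : M β) : RightFree α (g * of β x) := by
  obtain ⟨π, s, hβ, hπ⟩ := (pile g).exists_eq_ins β
  rw [RightFree, hπ, noTop_ins_of_adj h] at hg
  rw [RightFree, GraphProduct.pile_mul_of, hπ, RedPile.act_ins hβ, noTop_ins_of_adj h]
  exact hg

theorem RightFree.mul_of_not_adj {α β : V} {g : GraphProduct Γ M} (hg : RightFree β g)
    (hne : α ≠ β) (h : ¬ Γ.Adj α β) {x : M β} (hx : x ≠ 1) : RightFree α (g * of β x) := by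
  rw [RightFree, hg.pile_mul_of, ins_of_ne hx]
  exact noTop_push_of_not_adj hne h

theorem LengthLE.exists_rightFree {k : ℕ} {g : GraphProduct Γ M} (hg : LengthLE k g) (α : V) :
    ∃ (n : GraphProduct Γ M) (s : M α), LengthLE k n ∧ RightFree α n ∧ g = n * of α s := by
  induction k generalizing g α with
  | zero =>
    cases hg
    exact ⟨1, 1, .one 0, .one α, by simp⟩
  | succ k ih =>
    cases hg with
    | one => exact ⟨1, 1, .one _, .one α, by simp⟩
    | @mul _ g hg β x =>
      by_cases hαβ : α = β
      · subst hαβ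
        obtain ⟨n, s, hn, hα, rfl⟩ := ih hg α
        exact ⟨n, s * x, hn.mono k.le_succ, hα, by rw [map_mul, mul_assoc]⟩
      by_cases hadj : Γ.Adj α β
      · obtain ⟨n, s, hn, hα, rfl⟩ := ih hg α
        exact ⟨n * of β x, s, hn.mul β x, hα.mul_of_adj hadj x,
          by rw [mul_assoc, mul_assoc, of_mul_of_comm hadj]⟩
      obtain ⟨n, s, hn, hβ, hg'⟩ := ih hg β
      by_cases hx : s * x = 1
      · -- The two letters cancel, which leaves the product `n` of at most `k` letters.
        obtain ⟨m, t, hm, hα, rfl⟩ := ih hn α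
        exact ⟨m, t, hm.mono k.le_succ, hα,
          by rw [hg', mul_assoc, ← map_mul, hx, map_one, mul_one]⟩
      · refine ⟨n * of β (s * x), 1, hn.mul β _, hβ.mul_of_not_adj hαβ hadj hx, ?_⟩
        rw [hg', map_mul, map_one, mul_one, mul_assoc]

/-- Every nontrivial element ends, in a reduced expression, with a nontrivial letter. -/
theorem LengthLE.eq_one_or {k : ℕ} {g : GraphProduct Γ M} (hg : LengthLE k g) :
    g = 1 ∨ ∃ j < k, ∃ (β : V) (n : GraphProduct Γ M) (s : M β),
      LengthLE j n ∧ RightFree β n ∧ s ≠ 1 ∧ g = n * of β s := by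
  induction k generalizing g with
  | zero => cases hg; exact .inl rfl
  | succ k ih =>
    cases hg with
    | one => exact .inl rfl
    | @mul _ g hg β x =>
      obtain ⟨n, s, hn, hβ, rfl⟩ := hg.exists_rightFree β
      by_cases hx : s * x = 1
      · rw [mul_assoc, ← map_mul, hx, map_one, mul_one]
        exact (ih hn).imp_right fun ⟨j, hj, h⟩ => ⟨j, hj.trans k.lt_succ_self, h⟩
      · exact .inr ⟨k, k.lt_succ_self, β, n, s * x, hn, hβ, hx, by rw [map_mul, mul_assoc]⟩

theorem exists_eq_mul_of (g : GraphProduct Γ M) (α : V) :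
    ∃ (n : GraphProduct Γ M) (s : M α), RightFree α n ∧ g = n * of α s := by
  obtain ⟨k, hk⟩ := exists_lengthLE g
  obtain ⟨n, s, -, h⟩ := hk.exists_rightFree α
  exact ⟨n, s, h⟩

/-- Induction on a reduced expression, from left to right. -/
@[elab_as_elim]
theorem reduced_induction {P : GraphProduct Γ M → Prop} (one : P 1)
    (mul : ∀ n β (s : M β), RightFree β n → s ≠ 1 → P n → P (n * of β s))
    (g : GraphProduct Γ M) : P g := by
  obtain ⟨k, hk⟩ := exists_lengthLE g
  induction k using Nat.strong_induction_on generalizing g with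
  | _ k ih =>
    obtain rfl | ⟨j, hj, β, n, s, hn, hβ, hs, rfl⟩ := hk.eq_one_or
    · exact one
    · exact mul n β s hβ hs (ih j hj n hn)

/-- An element is determined by its reduced pile: peel off the last letter. -/
theorem pile_injective {g h : GraphProduct Γ M} (e : (pile g).1 = (pile h).1) : g = h := by
  induction g using reduced_induction generalizing h with
  | one =>
    induction h using reduced_induction with
    | one => rfl
    | mul n β s hβ hs _ =>
      rw [pile_one, hβ.pile_mul_of, ins_of_ne hs] at e
      exact absurd (e ▸ top_push β s _) (noTop_empty β s)
  | mul n β s hβ hs ih =>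
    obtain ⟨m, t, hm, rfl⟩ := exists_eq_mul_of h β
    rw [hβ.pile_mul_of, hm.pile_mul_of] at e
    obtain ⟨e', rfl⟩ := ins_inj hβ hm e
    rw [ih e']

/-- The graph product is a free right `M α`-act on its `RightFree α` elements. -/
theorem RightFree.mul_of_inj {α : V} {n m : GraphProduct Γ M} (hn : RightFree α n)
    (hm : RightFree α m) {s t : M α} (h : n * of α s = m * of α t) : n = m ∧ s = t := by
  have h' : ins α s (pile n).1 = ins α t (pile m).1 := by
    rw [← hn.pile_mul_of, ← hm.pile_mul_of, h]
  exact (ins_inj hn hm h').imp_left pile_injective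

theorem RightFree.eq_one_of_mul {α : V} {n : GraphProduct Γ M} (hn : RightFree α n) {s : M α}
    (h : RightFree α (n * of α s)) : s = 1 :=
  ((h.mul_of_inj hn (s := 1) (t := s) (by simp)).2).symm

/-! ### Supports -/

/-- The reduced expressions of `g` only use letters at vertices in `W`. -/
def SuppIn (W : Set V) (g : GraphProduct Γ M) : Prop :=
  ∀ D, ∀ l ∈ (pile g).1 D, l.1 ∈ W

theorem SuppIn.one (W : Set V) : SuppIn W (1 : GraphProduct Γ M) := fun D l hl => by
  rw [pile_one] at hl; simp at hl

theorem SuppIn.rightFree {W : Set V} {g : GraphProduct Γ M} (hg : SuppIn W g) {α : V}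
    (hα : α ∉ W) : RightFree α g := fun s hs => by
  have h := hs ⟨{α}, Set.pairwise_singleton _ _⟩ rfl
  exact hα (hg _ _ (List.mem_of_mem_head? h))

theorem SuppIn.of_mul {W : Set V} {n : GraphProduct Γ M} {β : V} {s : M β} (hn : RightFree β n)
    (h : SuppIn W (n * of β s)) : SuppIn W n := by
  by_cases hs : s = 1
  · rwa [hs, map_one, mul_one] at h
  intro D l hl
  refine h D l ?_
  rw [hn.pile_mul_of, ins_of_ne hs]
  by_cases hβ : β ∈ D.1
  · rw [push_of_mem hβ]; exact List.mem_cons_of_mem _ hl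
  · rwa [push_of_notMem hβ]

theorem SuppIn.eq_one_of_mul {W : Set V} {n : GraphProduct Γ M} {β : V} {s : M β}
    (hn : RightFree β n) (h : SuppIn W (n * of β s)) (hβ : β ∉ W) : s = 1 :=
  hn.eq_one_of_mul (h.rightFree hβ)

theorem SuppIn.mul {W : Set V} {g : GraphProduct Γ M} (hg : SuppIn W g) {β : V} (hβ : β ∈ W)
    (x : M β) : SuppIn W (g * of β x) := by
  obtain ⟨n, s, hn, rfl⟩ := exists_eq_mul_of g β
  have h := hg.of_mul hn
  rw [mul_assoc, ← map_mul]
  by_cases hx : s * x = 1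
  · rwa [hx, map_one, mul_one]
  intro D l hl
  rw [hn.pile_mul_of, ins_of_ne hx] at hl
  by_cases hD : β ∈ D.1
  · rw [push_of_mem hD] at hl
    obtain rfl | hl := List.mem_cons.1 hl
    · exact hβ
    · exact h D l hl
  · rw [push_of_notMem hD] at hl
    exact h D l hl

theorem SuppIn.mem_of_mul {W : Set V} {n : GraphProduct Γ M} {β : V} {s : M β}
    (hn : RightFree β n) (hs : s ≠ 1) (h : SuppIn W (n * of β s)) : β ∈ W :=
  by_contra fun hβ => hs (h.eq_one_of_mul hn hβ)

theorem SuppIn.comm_of {α : V} {c : GraphProduct Γ M} (hc : SuppIn (Γ.neighborSet α) c) (s : M α) :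
    c * of α s = of α s * c := by
  induction c using reduced_induction with
  | one => simp
  | mul n β x hn hx ih =>
    rw [mul_assoc, ← of_mul_of_comm (hc.mem_of_mul hn hx), ← mul_assoc, ih (hc.of_mul hn),
      mul_assoc]

theorem RightFree.mul_of_suppIn {α : V} {g c : GraphProduct Γ M} (hg : RightFree α g)
    (hc : SuppIn (Γ.neighborSet α) c) : RightFree α (g * c) := by
  induction c using reduced_induction with
  | one => simpa
  | mul n β x hn hx ih =>
    rw [← mul_assoc]
    exact (ih (hc.of_mul hn)).mul_of_adj (hc.mem_of_mul hn hx) x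

/-! ### Left multiplication and right decompositions -/

/-- A letter multiplied on the left becomes a right factor only if it is at the vertex `α` in question
and commutes with all that follows it. -/
theorem RightFree.of_mul_or {α β : V} {n : GraphProduct Γ M} (hn : RightFree α n) (s : M β) :
    RightFree α (of β s * n) ∨ α = β ∧ SuppIn (Γ.neighborSet α) n := by
  induction n using reduced_induction generalizing α β with
  | one =>
    by_cases hαβ : α = β
    · exact .inr ⟨hαβ, .one _⟩
    left
    rw [mul_one, ← one_mul (of β s)]
    by_cases hadj : Γ.Adj α β
    · exact (RightFree.one α).mul_of_adj hadj s
    by_cases hs : s = 1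
    · simpa [hs] using RightFree.one α
    · exact (RightFree.one β).mul_of_not_adj hαβ hadj hs
  | mul n γ x hγ hx ih =>
    have hαγ : α ≠ γ := by
      rintro rfl
      exact hx (hγ.eq_one_of_mul hn)
    rw [← mul_assoc]
    by_cases hadj : Γ.Adj α γ
    · have hα : RightFree α n := by
        obtain ⟨m, t, hm, rfl⟩ := exists_eq_mul_of n α
        rw [mul_assoc, of_mul_of_comm hadj, ← mul_assoc] at hn
        rw [(hm.mul_of_adj hadj x).eq_one_of_mul hn]
        simpa
      exact (ih hα s).imp (fun h => h.mul_of_adj hadj x) fun h => ⟨h.1, h.2.mul hadj x⟩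
    · left
      obtain h | ⟨rfl, h⟩ := ih hγ s
      · exact h.mul_of_not_adj hαγ hadj hx
      · rw [← h.comm_of, mul_assoc, ← map_mul]
        by_cases hsx : s * x = 1
        · rw [hsx, map_one, mul_one]
          exact h.rightFree fun h' => hadj (SimpleGraph.Adj.symm h')
        · exact hγ.mul_of_not_adj hαγ hadj hsx

/-- `n` stays right free for `α` under all left multiplications. -/
def StablyRightFree (α : V) (n : GraphProduct Γ M) : Prop :=
  ∀ u, RightFree α (u * n)

/-- Along a product `u * n`, the last letter in `M α` can change only when a suffix of `u` has reduced
`n` to a product of letters commuting with `M α`; by assumption such an `n` may be replaced by an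
element with support in the neighbours of `α`. -/
theorem RightFree.stablyRightFree_or {α : V} {n : GraphProduct Γ M} {k : ℕ}
    (hn : RightFree α n) (hk : ∀ (W : Set V) u, SuppIn W (u * n) →
      ∃ c, LengthLE k c ∧ SuppIn W c ∧ LeftAssoc c n) :
    StablyRightFree α n ∨
      ∃ c, LengthLE k c ∧ SuppIn (Γ.neighborSet α) c ∧ LeftAssoc c n := by
  refine or_iff_not_imp_right.2 fun hc u => ?_
  induction u using induction_left with
  | one => rwa [one_mul]
  | mul u β s ih =>
    rw [mul_assoc]
    exact (ih.of_mul_or s).resolve_right fun h => hc (hk _ u h.2)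

/-- If some left multiple of `a` has support in `W`, then `a` generates the same left ideal as an
element with support in `W`, which is not longer than `a`: the letters outside `W` can be
cancelled from the left. -/
theorem LengthLE.exists_suppIn {k : ℕ} {a : GraphProduct Γ M} (ha : LengthLE k a) {W : Set V}
    {u : GraphProduct Γ M} (hu : SuppIn W (u * a)) :
    ∃ c, LengthLE k c ∧ SuppIn W c ∧ LeftAssoc c a := by
  induction k using Nat.strong_induction_on generalizing a W u with
  | _ k ih =>
    obtain rfl | ⟨j, hj, γ, n, x, hn, hγ, hx, rfl⟩ := ha.eq_one_or
    · exact ⟨1, .one k, .one W, .refl 1⟩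
    obtain ⟨n', s, hn', hs⟩ := exists_eq_mul_of (u * n) γ
    have e : u * (n * of γ x) = n' * of γ (s * x) := by rw [← mul_assoc, hs, map_mul, mul_assoc]
    rw [e] at hu
    by_cases hW : γ ∈ W
    · obtain ⟨c, hcj, hc, hcn⟩ := ih j hj hn (u := u) (hs ▸ (hu.of_mul hn').mul hW s)
      exact ⟨c * of γ x, (hcj.mul γ x).mono hj, hc.mul hW x, hcn.mul_right _⟩
    -- The letter `x` is at a vertex outside `W`, so it has to cancel.
    have hsx : s * x = 1 := hu.eq_one_of_mul hn' hW
    obtain hst | ⟨c, hcj, hc, ⟨v', hv'⟩, v, hv⟩ :=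
      hγ.stablyRightFree_or fun W u => ih j hj hn (W := W) (u := u)
    · have hs1 : s = 1 := hn'.eq_one_of_mul (hs ▸ hst u)
      rw [hs1, one_mul] at hsx
      exact absurd hsx hx
    -- The element before `x` can be replaced by `c`, which commutes with `x`, so that the
    -- left-invertible letter `x` can be dropped.
    obtain ⟨n'', t, hn'', ht⟩ := exists_eq_mul_of (u * v) γ
    have e' : u * n = n'' * c * of γ t := by
      rw [hv, ← mul_assoc, ht, mul_assoc, ← hc.comm_of, mul_assoc]
    obtain ⟨rfl, rfl⟩ := (hn''.mul_of_suppIn hc).mul_of_inj hn' (e'.symm.trans hs)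
    obtain ⟨c', hc'j, hc', hc'c⟩ := ih j hj hcj (u := n'') (hu.of_mul hn')
    have hinv : of γ t * of γ x = (1 : GraphProduct Γ M) := by rw [← map_mul, hsx, map_one]
    refine ⟨c', hc'j.mono hj.le, hc', hc'c.trans ⟨⟨of γ t * v', ?_⟩, v * of γ x, ?_⟩⟩
    · rw [mul_assoc, ← mul_assoc v', ← hv', hc.comm_of, ← mul_assoc, hinv, one_mul]
    · rw [mul_assoc, ← hc.comm_of, ← mul_assoc, ← hv]

/-- `RightFree.stablyRightFree_or` with its hypothesis discharged by `LengthLE.exists_suppIn`, whose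
induction uses the conditional form. -/
theorem LengthLE.stablyRightFree_or {k : ℕ} {n : GraphProduct Γ M} (hk : LengthLE k n) {α : V}
    (hn : RightFree α n) : StablyRightFree α n ∨
      ∃ c, LengthLE k c ∧ SuppIn (Γ.neighborSet α) c ∧ LeftAssoc c n :=
  hn.stablyRightFree_or fun _ _ hu => hk.exists_suppIn hu

/-! ### Annihilators and intersections in a graph product -/

theorem StablyRightFree.annFG_mul {α : V} {n : GraphProduct Γ M} (hn : StablyRightFree α n)
    (h : AnnFG n) (r : M α) : AnnFG (n * of α r) := by
  refine h.imp fun R hR => ⟨hR.1, fun p hp => ?_, fun u v huv => hR.2.2 u v ?_⟩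
  · simp only [← mul_assoc, show p.1 * n = p.2 * n from hR.2.1 p hp]
  · simp only [← mul_assoc] at huv
    exact ((hn u).mul_of_inj (hn v) huv).1

theorem SuppIn.annFG_mul {α : V} {c : GraphProduct Γ M} (hc : SuppIn (Γ.neighborSet α) c)
    (h : AnnFG c) {r : M α} (hr : AnnFG r) : AnnFG (c * of α r) := by
  obtain ⟨R, hR, hR₁, hR₂⟩ := h
  obtain ⟨H, hH, hH₁, hH₂⟩ := hr
  refine ⟨R ∪ Prod.map (of α) (of α) '' H, hR.union (hH.image _), ?_, fun u v huv => ?_⟩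
  · rintro _ (hp | ⟨p, hp, rfl⟩)
    · simp only [← mul_assoc, hR₁ _ hp]
    · simp only [Prod.map, hc.comm_of, ← mul_assoc, ← map_mul, hH₁ p hp]
  · obtain ⟨n, s, hn, rfl⟩ := exists_eq_mul_of u α
    obtain ⟨m, t, hm, rfl⟩ := exists_eq_mul_of v α
    have e : ∀ (n : GraphProduct Γ M) (s : M α),
        n * of α s * (c * of α r) = n * c * of α (s * r) := fun n s => by
      rw [map_mul, mul_assoc, ← mul_assoc (of α s), ← hc.comm_of]
      simp only [mul_assoc]
    simp only [e] at huv
    obtain ⟨h₁, h₂⟩ := (hn.mul_of_suppIn hc).mul_of_inj (hm.mul_of_suppIn hc) huv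
    -- Move from `n * s` to `m * s` in the annihilator of `c`, then to `m * t` in that of `r`.
    refine .trans (y := m * of α s) ?_ ?_
    · refine (hR₂ _ _ ?_).mono fun x y hxy => Or.inl hxy
      simp only [mul_assoc, ← hc.comm_of]
      rw [← mul_assoc, h₁, mul_assoc]
    · refine ActCongGen.smul m ((hH₂ s t h₂).map (of α) (of α) (fun _ _ => map_mul _ _ _) ?_)
      exact fun x y hxy => .of (Or.inr ⟨(x, y), hxy, rfl⟩)

theorem LengthLE.annFG {k : ℕ} {a : GraphProduct Γ M} (ha : LengthLE k a)
    (h : ∀ α (x : M α), AnnFG x) : AnnFG a := by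
  induction k using Nat.strong_induction_on generalizing a with
  | _ k ih =>
    obtain rfl | ⟨j, hj, α, n, r, hn, hα, -, rfl⟩ := ha.eq_one_or
    · exact ⟨∅, Set.finite_empty, by simp, fun u v huv => by
        obtain rfl : u = v := by simpa using huv
        exact .refl u⟩
    obtain hst | ⟨c, hcj, hc, hcn⟩ := hn.stablyRightFree_or hα
    · exact hst.annFG_mul (ih j hj hn) r
    · exact (hc.annFG_mul (ih j hj hcj) (h α r)).of_leftAssoc (hcn.mul_right _)

/-- If both elements are stable, the letters at `α` have to agree. -/
theorem StablyRightFree.interFG_mul {α : V} {a b : GraphProduct Γ M} (ha : StablyRightFree α a)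
    (hb : StablyRightFree α b) (h : InterFG a b) (r t : M α) :
    InterFG (a * of α r) (b * of α t) := by
  by_cases hrt : r = t
  · subst hrt
    obtain ⟨F, hF, hF₁⟩ := h
    refine ⟨(· * of α r) '' F, hF.image _, fun w => ⟨?_, ?_⟩⟩
    · rintro ⟨⟨u, rfl⟩, v, hv⟩
      simp only [← mul_assoc] at hv
      obtain ⟨f, hf, p, hp⟩ := (hF₁ (u * a)).1 ⟨⟨u, rfl⟩, v, ((ha u).mul_of_inj (hb v) hv).1⟩
      exact ⟨_, ⟨f, hf, rfl⟩, p, by rw [← mul_assoc, ← mul_assoc, hp]⟩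
    · rintro ⟨_, ⟨f, hf, rfl⟩, p, rfl⟩
      obtain ⟨⟨u, hu⟩, v, hv⟩ := (hF₁ (p * f)).2 ⟨f, hf, p, rfl⟩
      exact ⟨⟨u, by simp only [← mul_assoc, hu]⟩, v, by simp only [← mul_assoc, hv]⟩
  · refine .of_forall_not fun u v huv => hrt ?_
    simp only [← mul_assoc] at huv
    exact ((ha u).mul_of_inj (hb v) huv).2

/-- A stable element fixes the letter `r` at `α`, which the commuting element `c` has to match by a
left multiple of `t`. -/
theorem StablyRightFree.interFG_mul_suppIn {α : V} {a c : GraphProduct Γ M}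
    (ha : StablyRightFree α a) (hc : SuppIn (Γ.neighborSet α) c) (h : InterFG a c) (r t : M α) :
    InterFG (a * of α r) (c * of α t) := by
  by_cases hrt : ∃ m, r = m * t
  · obtain ⟨m, rfl⟩ := hrt
    obtain ⟨F, hF, hF₁⟩ := h
    refine ⟨(· * of α (m * t)) '' F, hF.image _, fun w => ⟨?_, ?_⟩⟩
    · rintro ⟨⟨u, rfl⟩, v, hv⟩
      obtain ⟨n, s, hn, rfl⟩ := exists_eq_mul_of v α
      have e : u * a * of α (m * t) = n * c * of α (s * t) := by
        rw [mul_assoc, hv, map_mul, mul_assoc, ← mul_assoc (of α s), ← hc.comm_of]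
        simp only [mul_assoc]
      obtain ⟨f, hf, p, hp⟩ := (hF₁ (u * a)).1 ⟨⟨u, rfl⟩, n,
        ((ha u).mul_of_inj (hn.mul_of_suppIn hc) e).1⟩
      exact ⟨_, ⟨f, hf, rfl⟩, p, by rw [← mul_assoc, ← mul_assoc, hp]⟩
    · rintro ⟨_, ⟨f, hf, rfl⟩, p, rfl⟩
      obtain ⟨⟨u, hu⟩, v, hv⟩ := (hF₁ (p * f)).2 ⟨f, hf, p, rfl⟩
      refine ⟨⟨u, by simp only [← mul_assoc, hu]⟩, v * of α m, ?_⟩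
      rw [← mul_assoc, hv, map_mul, mul_assoc, ← mul_assoc c, hc.comm_of]
      simp only [mul_assoc]
  · refine .of_forall_not fun u v huv => hrt ?_
    obtain ⟨n, s, hn, rfl⟩ := exists_eq_mul_of v α
    have e : u * a * of α r = n * c * of α (s * t) := by
      rw [mul_assoc, huv, map_mul, mul_assoc, ← mul_assoc (of α s), ← hc.comm_of]
      simp only [mul_assoc]
    exact ⟨s, ((ha u).mul_of_inj (hn.mul_of_suppIn hc) e).2⟩

/-- If both elements commute with `M α`, the intersection splits into one in the graph product and
one in `M α`. -/
theorem SuppIn.interFG_mul {α : V} {c d : GraphProduct Γ M} (hc : SuppIn (Γ.neighborSet α) c)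
    (hd : SuppIn (Γ.neighborSet α) d) (h : InterFG c d) {r t : M α} (hrt : InterFG r t) :
    InterFG (c * of α r) (d * of α t) := by
  obtain ⟨F, hF, hF₁⟩ := h
  obtain ⟨E, hE, hE₁⟩ := hrt
  have key : ∀ {c : GraphProduct Γ M}, SuppIn (Γ.neighborSet α) c → ∀ n (s r : M α),
      n * of α s * (c * of α r) = n * c * of α (s * r) := fun hc n s r => by
    rw [map_mul, mul_assoc, ← mul_assoc (of α s), ← hc.comm_of]
    simp only [mul_assoc]
  refine ⟨Set.image2 (fun f x => f * of α x) F E, hF.image2 _ hE, fun w => ⟨?_, ?_⟩⟩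
  · rintro ⟨⟨u, rfl⟩, v, hv⟩
    obtain ⟨n, s, hn, rfl⟩ := exists_eq_mul_of u α
    obtain ⟨m, s', hm, rfl⟩ := exists_eq_mul_of v α
    rw [key hc, key hd] at hv
    obtain ⟨h₁, h₂⟩ := (hn.mul_of_suppIn hc).mul_of_inj (hm.mul_of_suppIn hd) hv
    obtain ⟨x, hx, y, hy⟩ := (hE₁ (s * r)).1 ⟨⟨s, rfl⟩, s', h₂⟩
    obtain ⟨f, hf, p, hp⟩ := (hF₁ (n * c * of α y)).1 ⟨⟨n * of α y, by
      rw [mul_assoc, hc.comm_of, mul_assoc]⟩, m * of α y, by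
      rw [h₁, mul_assoc, hd.comm_of, mul_assoc]⟩
    exact ⟨_, ⟨f, hf, x, hx, rfl⟩, p, by
      rw [key hc, hy, map_mul, ← mul_assoc, hp, mul_assoc]⟩
  · rintro ⟨_, ⟨f, hf, x, hx, rfl⟩, p, rfl⟩
    obtain ⟨⟨u, hu⟩, v, hv⟩ := (hF₁ (p * f)).2 ⟨f, hf, p, rfl⟩
    obtain ⟨⟨y, hy⟩, z, hz⟩ := (hE₁ x).2 ⟨x, hx, 1, (one_mul x).symm⟩
    exact ⟨⟨u * of α y, by rw [key hc, ← hy, ← hu, mul_assoc]⟩,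
      v * of α z, by rw [key hd, ← hz, ← hv, mul_assoc]⟩

theorem LengthLE.interFG {i j : ℕ} {a b : GraphProduct Γ M} (ha : LengthLE i a) (hb : LengthLE j b)
    (h : ∀ α (x y : M α), InterFG x y) : InterFG a b := by
  induction i using Nat.strong_induction_on generalizing a b with
  | _ i ih =>
    obtain rfl | ⟨i', hi, α, n, r, hn, hα, -, rfl⟩ := ha.eq_one_or
    · exact ⟨{b}, Set.finite_singleton b, fun w => by simp⟩
    obtain ⟨m, t, hm, hmα, rfl⟩ := hb.exists_rightFree α
    obtain hna | ⟨c, hci, hc, hcn⟩ := hn.stablyRightFree_or hα <;>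
      obtain hmb | ⟨d, hdj, hd, hdm⟩ := hm.stablyRightFree_or hmα
    · exact hna.interFG_mul hmb (ih i' hi hn hm) r t
    · exact ((hna.interFG_mul_suppIn hd (ih i' hi hn hdj) r t).symm.of_leftAssoc
        (hdm.mul_right _)).symm
    · exact (hmb.interFG_mul_suppIn hc (ih i' hi hci hm).symm t r).symm.of_leftAssoc
        (hcn.mul_right _)
    · exact ((hc.interFG_mul hd (ih i' hi hci hdj) (h α r t)).of_leftAssoc
        (hcn.mul_right _)).symm.of_leftAssoc (hdm.mul_right _) |>.symm

end GraphProduct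

theorem theorem7p1 {V : Type*} (Γ : SimpleGraph V) (M : V → Type*) [∀ α, Monoid (M α)] :
    WeaklyLeftCoherent (GraphProduct Γ M) ↔ ∀ α, WeaklyLeftCoherent (M α) := by
  refine ⟨fun h α => ?_, fun h => weaklyLeftCoherent_iff.2 ⟨fun a => ?_, fun a b => ?_⟩⟩
  · obtain ⟨π, hπ⟩ := GraphProduct.exists_retraction Γ M α
    exact h.of_retract (GraphProduct.of α) π hπ
  · obtain ⟨k, hk⟩ := GraphProduct.exists_lengthLE a
    exact hk.annFG fun α => (h α).annFG
  · obtain ⟨i, hi⟩ := GraphProduct.exists_lengthLE a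
    obtain ⟨j, hj⟩ := GraphProduct.exists_lengthLE b
    exact hi.interFG hj fun α => (h α).interFG
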